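/- Let $d\ge 2$ and $N\ge 2$ be integers. Consider $N$ spinless particles of unit mass in $\mathbb{R}^d$ which attract each other through the pair potential $-1/r$, and let $H$ be the self-adjoint operator on $L^2(\mathbb{R}^{(N-1)d})$ (associated with its energy form) obtained from $-\frac12\sum_{i=0}^{N-1}\Delta_i-\sum_{0\le i<j\le N-1}\frac{1}{\|r_j-r_i\|}$ by removing the centre of mass, the variables being the relative coordinates $(r_1-r_0,\dots,r_{N-1}-r_0)$. For $M\ge 2$ distinct points $x_0,\dots,x_{M-1}$ of $\mathbb{R}^d$ let $$F_M(x_0,\dots,x_{M-1})=\sum_{(\widehat{j,i,k})}\cos(\widehat{j,i,k}),$$ where the sum runs over all $M(M-1)(M-2)/2$ angles at a vertex $x_i$ between $x_j-x_i$ and $x_k-x_i$, with $i,j,k$ pairwise distinct and $\{j,k\}$ unordered (so $F_2=0$). Let $\sup F_M$ be its supremum over all configurations of $M$ distinct points of $\mathbb{R}^d$, and for $M\ge3$ put $$\alpha_M=\frac{\sup F_M}{M(M-1)(M-2)}.$$ Then the following hold. 1. If $H$ has a lowest eigenvalue $e_0$, then $$e_0\;\ge\;-\frac{N^2(N-1)}{4(d-1)^2},$$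 and, for every integer $M$ with $3\le M\le N$, $$e_0\;\ge\;-\frac{N(N-1)\left(\frac12+\alpha_M(N-2)\right)}{(d-1)^2}.$$ 2. For every $M\ge 2$ the supremum $\sup F_M$ is finite and $\sup F_M\le \frac{M(M-1)(M-2)}{4}$ (in particular for $M=N$); hence $\alpha_M\le\frac14$ for every $M\ge3$. Moreover $\sup F_3=\frac32$. -/

import Mathlib

open MeasureTheory
open scoped ContDiff ComplexConjugate

/-! ### Configurations, interparticle potential and angular function -/

/-- The space `ℝ^{nd}` of the relative coordinates `(r₁ - r₀, …, r_n - r₀)` of `n + 1` particles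
in `ℝ^d`, endowed with Lebesgue measure. -/
abbrev RelConfig (d n : ℕ) : Type := Fin n → EuclideanSpace ℝ (Fin d)

/-- The positions of the `n + 1` particles, in the frame in which `r₀ = 0`. -/
def positions {d n : ℕ} (q : RelConfig d n) : Fin (n + 1) → EuclideanSpace ℝ (Fin d) :=
  Fin.cons 0 q

/-- The attractive Coulomb potential `V = - ∑_{i < j} 1 / ‖r_j - r_i‖`. -/
noncomputable def coulombPotential {d n : ℕ} (q : RelConfig d n) : ℝ :=
  ∑ i : Fin (n + 1), ∑ j : Fin (n + 1),
    if i < j then -(1 / ‖positions q j - positions q i‖) else 0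

/-- The angular function `F_N`: the sum of `cos (j,i,k)` over all the `N(N-1)(N-2)/2` angles
(vertex `i`, unordered pair `{j, k}`) made by three distinct points among `x₀, …, x_{N-1}`. -/
noncomputable def angularSum {d N : ℕ} (x : Fin N → EuclideanSpace ℝ (Fin d)) : ℝ :=
  ∑ i : Fin N, ∑ j : Fin N, ∑ k : Fin N,
    if j < k ∧ j ≠ i ∧ k ≠ i then Real.cos (EuclideanGeometry.angle (x j) (x i) (x k)) else 0

/-- The values of `F_N` on the configurations of `N` distinct points of `ℝ^d`. -/
def angularValues (d N : ℕ) : Set ℝ :=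
  {t | ∃ x : Fin N → EuclideanSpace ℝ (Fin d), Function.Injective x ∧ angularSum x = t}

/-- `sup F_N` over the configurations of `N` distinct points of `ℝ^d`. -/
noncomputable def angularSup (d N : ℕ) : ℝ := sSup (angularValues d N)

/-- `α_M = sup F_M / (M (M - 1) (M - 2))`. -/
noncomputable def alphaConst (d M : ℕ) : ℝ :=
  angularSup d M / ((M : ℝ) * ((M : ℝ) - 1) * ((M : ℝ) - 2))

/-! ### The Hamiltonian with the centre of mass removed -/

/-- `g` is the weak partial derivative of `ψ` with respect to the `a`-th component of the `k`-th
relative coordinate. -/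
def IsWeakPartial {d n : ℕ} (k : Fin n) (a : Fin d) (ψ g : RelConfig d n → ℂ) : Prop :=
  ∀ η : RelConfig d n → ℝ, ContDiff ℝ ∞ η → HasCompactSupport η →
    ∫ q, fderiv ℝ η q (Pi.single k (EuclideanSpace.single a 1)) • ψ q = -∫ q, η q • g q

/-- `ψ` belongs to the form domain of the Hamiltonian and `G k a` are its weak partial derivatives:
`ψ` lies in the Sobolev space `H¹(ℝ^{nd})`, and `|V|^{1/2} ψ` is square integrable. -/
structure InFormDomain {d n : ℕ} (ψ : RelConfig d n → ℂ)
    (G : Fin n → Fin d → RelConfig d n → ℂ) : Prop where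
  memLp : MemLp ψ 2
  memLp_grad : ∀ k a, MemLp (G k a) 2
  weak_grad : ∀ k a, IsWeakPartial k a ψ (G k a)
  integrable_potential : Integrable fun q => coulombPotential q * ‖ψ q‖ ^ 2

/-- The `a`-th component of the gradient with respect to the position of the `i`-th particle,
expressed through the derivatives `G` with respect to the relative coordinates: for
`f(r₁ - r₀, …, r_n - r₀)` one has `∇_{r_k} = ∇_{q_k}` for `k ≥ 1` and `∇_{r₀} = - ∑_k ∇_{q_k}`. -/
noncomputable def particleGrad {d n : ℕ} (G : Fin n → Fin d → RelConfig d n → ℂ)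
    (i : Fin (n + 1)) (a : Fin d) (q : RelConfig d n) : ℂ :=
  Fin.cases (motive := fun _ => ℂ) (-∑ k, G k a q) (fun k => G k a q) i

/-- The sesquilinear form `⟨χ | H ψ⟩` of `H = - ½ ∑ᵢ Δᵢ + V` (unit masses) on functions of the
relative coordinates; `Gχ`, `Gψ` are the weak gradients of `χ`, `ψ`. -/
noncomputable def energyForm {d n : ℕ} (χ : RelConfig d n → ℂ)
    (Gχ : Fin n → Fin d → RelConfig d n → ℂ) (ψ : RelConfig d n → ℂ)
    (Gψ : Fin n → Fin d → RelConfig d n → ℂ) : ℂ :=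
  (1 / 2 : ℂ) * ∑ i : Fin (n + 1), ∑ a : Fin d,
      (∫ q, conj (particleGrad Gχ i a q) * particleGrad Gψ i a q)
    + (∫ q, (coulombPotential q : ℂ) * (conj (χ q) * ψ q))

/-- The graph of the self-adjoint operator `H` on `L²(ℝ^{nd})` associated with the energy form:
`ψ` lies in the domain of `H` and `H ψ = f` iff `ψ` lies in the form domain, `f` is square
integrable and `⟨χ | f⟩` is the energy form of `(χ, ψ)` for every `χ` in the form domain. -/
def HamiltonianMapsTo {d n : ℕ} (ψ f : RelConfig d n → ℂ) : Prop :=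
  MemLp f 2 ∧ ∃ Gψ, InFormDomain ψ Gψ ∧
    ∀ χ Gχ, InFormDomain χ Gχ → energyForm χ Gχ ψ Gψ = ∫ q, conj (χ q) * f q

/-- `e` is an eigenvalue of the Hamiltonian `H` of `N` identical attractive Coulombian particles
in `ℝ^d`, the centre of mass being removed. -/
def IsEnergyLevel (d N : ℕ) (e : ℝ) : Prop :=
  ∃ ψ : RelConfig d (N - 1) → ℂ, ¬ (ψ =ᵐ[volume] 0) ∧
    HamiltonianMapsTo ψ (fun q => (e : ℂ) * ψ q)

/-!
Let `G_i = ∑_{j ≠ i} (r_j - r_i) / ‖r_j - r_i‖` be the sum of the unit vectors pointing from the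
`i`-th particle to the others. In dimension `d` a unit vector field `y / ‖y‖` has divergence
`(d - 1) / ‖y‖`, so expanding `∑_i ∫ |∇_i ψ - μ G_i ψ|² ≥ 0` and integrating the cross term by parts
gives `∑_i ∫ |∇_i ψ|² ≥ ∫ (2 μ (d - 1) ∑_{i < j} 1 / r_{ij} - μ² ∑_i |G_i|²) |ψ|²`. With
`μ = 1 / (d - 1)` the first term on the right is cancelled by the potential energy. Moreover
`∑_i |G_i|² = N (N - 1) + 2 F_N` (`sum_norm_sum_unit_sq`), so that an upper bound on `F_N` gives a
lower bound on the energy of every state (`InFormDomain.le_energy`), hence on every eigenvalue.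

Two points need care. The field is singular at collisions, so `y / ‖y‖` is replaced by
`y / √(‖y‖² + ε²)`, whose divergence is at least `(d - 1) / √(‖y‖² + ε²)`; the limit `ε → 0` is
taken by dominated convergence, the integrability of `V |ψ|²` being part of the form domain. And
`ψ` has only a weak gradient: the integration by parts `∫ (∂_v g) u² = - 2 ∫ g u ∂_v u` for smooth
bounded `g` (`HasWeakDirDeriv.integral_fderiv_mul_sq`) is obtained by
differentiating `t ↦ ∫ g (x) u (x + t v)² dx` in two ways, using that `t ↦ u (· + t v)` is differentiable
in `L²` (`HasWeakDirDeriv.hasDerivAt_vadd`).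

For the angular function, the cosines of a triangle add up to at most `3 / 2`, with equality for
equilateral triangles, and averaging over the deletions of one point
(`sum_angularSum_succAbove`) shows that a bound `F_M ≤ c M (M - 1) (M - 2)` passes on to all larger
numbers of points.
-/

open Topology Filter

/-! ### The angular function -/

/-- The sum of the three cosines of a (possibly flat) triangle is at most `3 / 2`: the unit vectors
along the three sides, taken cyclically, have the negatives of the three cosines as inner
products, and their sum has a nonnegative square norm. -/
theorem cos_angle_add_cos_angle_add_cos_angle_le {V : Type*} [NormedAddCommGroup V]
    [InnerProductSpace ℝ V] {x y z : V} (hxy : x ≠ y) (hyz : y ≠ z) (hzx : z ≠ x) :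
    Real.cos (EuclideanGeometry.angle y x z) + Real.cos (EuclideanGeometry.angle x y z) +
      Real.cos (EuclideanGeometry.angle x z y) ≤ 3 / 2 := by
  simp only [EuclideanGeometry.angle, InnerProductGeometry.cos_angle, vsub_eq_sub]
  have h1 : ‖y - x‖ ≠ 0 := norm_ne_zero_iff.2 (sub_ne_zero.2 hxy.symm)
  have h2 : ‖z - y‖ ≠ 0 := norm_ne_zero_iff.2 (sub_ne_zero.2 hyz.symm)
  have h3 : ‖x - z‖ ≠ 0 := norm_ne_zero_iff.2 (sub_ne_zero.2 hzx.symm)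
  have key : 0 ≤ ‖‖y - x‖⁻¹ • (y - x) + ‖z - y‖⁻¹ • (z - y) + ‖x - z‖⁻¹ • (x - z)‖ ^ 2 := by
    positivity
  rw [norm_add_sq_real, norm_add_sq_real, inner_add_left] at key
  simp only [norm_smul, norm_inv, norm_norm, inv_mul_cancel₀ h1, inv_mul_cancel₀ h2,
    inv_mul_cancel₀ h3, real_inner_smul_left, real_inner_smul_right] at key
  have e1 : inner ℝ (y - x) (z - x) = -inner ℝ (y - x) (x - z) := by
    rw [← inner_neg_right, neg_sub]
  have e2 : inner ℝ (x - y) (z - y) = -inner ℝ (y - x) (z - y) := by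
    rw [← inner_neg_left, neg_sub]
  have e3 : inner ℝ (x - z) (y - z) = -inner ℝ (z - y) (x - z) := by
    rw [real_inner_comm, ← inner_neg_left, neg_sub]
  rw [e1, e2, e3, norm_sub_rev z x, norm_sub_rev x y, norm_sub_rev y z]
  field_simp at key ⊢
  linarith

theorem angularSum_two {d : ℕ} (x : Fin 2 → EuclideanSpace ℝ (Fin d)) : angularSum x = 0 := by
  simp [angularSum, Fin.sum_univ_two]

theorem angularSum_three {d : ℕ} (x : Fin 3 → EuclideanSpace ℝ (Fin d)) :
    angularSum x = Real.cos (EuclideanGeometry.angle (x 1) (x 0) (x 2)) +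
      Real.cos (EuclideanGeometry.angle (x 0) (x 1) (x 2)) +
      Real.cos (EuclideanGeometry.angle (x 0) (x 2) (x 1)) := by
  simp [angularSum, Fin.sum_univ_three]

theorem angularSum_three_le {d : ℕ} {x : Fin 3 → EuclideanSpace ℝ (Fin d)}
    (hx : Function.Injective x) : angularSum x ≤ 3 / 2 := by
  rw [angularSum_three]
  exact cos_angle_add_cos_angle_add_cos_angle_le (hx.ne (by decide)) (hx.ne (by decide))
    (hx.ne (by decide))

/-- Deleting one point in all possible ways counts every angle of an `(N + 1)`-point configuration
`N - 2` times. -/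
theorem sum_angularSum_succAbove {d N : ℕ} (x : Fin (N + 1) → EuclideanSpace ℝ (Fin d)) :
    ∑ p : Fin (N + 1), angularSum (x ∘ p.succAbove) = ((N : ℝ) - 2) * angularSum x := by
  set f : Fin (N + 1) → Fin (N + 1) → Fin (N + 1) → ℝ := fun i j k =>
    if j < k ∧ j ≠ i ∧ k ≠ i then Real.cos (EuclideanGeometry.angle (x j) (x i) (x k)) else 0
    with hf
  have hsum : ∀ (p : Fin (N + 1)) (g : Fin (N + 1) → ℝ),
      ∑ i, g (p.succAbove i) = ∑ i, if p ≠ i then g i else 0 := fun p g => by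
    rw [Fin.sum_univ_succAbove _ p]
    simp [Fin.ne_succAbove]
  have h1 : ∀ p, angularSum (x ∘ p.succAbove) =
      ∑ i, ∑ j, ∑ k, if p ≠ i ∧ p ≠ j ∧ p ≠ k then f i j k else 0 := fun p => by
    have : angularSum (x ∘ p.succAbove) =
        ∑ i, ∑ j, ∑ k, f (p.succAbove i) (p.succAbove j) (p.succAbove k) := by
      simp [angularSum, hf, Fin.succAbove_lt_succAbove_iff]
    rw [this]
    rw [hsum p fun i => ∑ j, ∑ k, f i (p.succAbove j) (p.succAbove k)]
    refine Finset.sum_congr rfl fun i _ => ?_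
    by_cases hi : p = i
    · simp [hi]
    rw [if_pos hi, hsum p fun j => ∑ k, f i j (p.succAbove k)]
    refine Finset.sum_congr rfl fun j _ => ?_
    by_cases hj : p = j
    · simp [hj]
    rw [if_pos hj, hsum p fun k => f i j k]
    refine Finset.sum_congr rfl fun k _ => ?_
    simp [hi, hj]
  simp_rw [h1]
  have h2 : angularSum x = ∑ i, ∑ j, ∑ k, f i j k := rfl
  rw [h2, Finset.sum_comm, Finset.mul_sum]
  refine Finset.sum_congr rfl fun i _ => ?_
  rw [Finset.sum_comm, Finset.mul_sum]
  refine Finset.sum_congr rfl fun j _ => ?_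
  rw [Finset.sum_comm, Finset.mul_sum]
  refine Finset.sum_congr rfl fun k _ => ?_
  by_cases h : j < k ∧ j ≠ i ∧ k ≠ i
  · have hcard : (Finset.univ.filter fun p => p ≠ i ∧ p ≠ j ∧ p ≠ k).card + 3 = N + 1 := by
      have : (Finset.univ.filter fun p : Fin (N + 1) => p ≠ i ∧ p ≠ j ∧ p ≠ k) =
          ({i, j, k} : Finset (Fin (N + 1)))ᶜ := by
        ext p; simp
      rw [this, ← Finset.card_eq_three.2 ⟨i, j, k, h.2.1.symm, h.2.2.symm, h.1.ne, rfl⟩,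
        Finset.card_compl_add_card, Fintype.card_fin]
    rw [← Finset.sum_filter, Finset.sum_const, nsmul_eq_mul]
    have : ((Finset.univ.filter fun p => p ≠ i ∧ p ≠ j ∧ p ≠ k).card : ℝ) = N - 2 := by
      have := congrArg (Nat.cast : ℕ → ℝ) hcard
      push_cast at this
      linarith
    rw [this]
  · simp [hf, h]

/-- A bound `F_M ≤ c M (M - 1) (M - 2)` passes on to all larger numbers of points: it suffices to
average it over the deletions of one point. For `M = 2` the averaging is void, since deleting a
vertex of a triangle leaves no angle. -/
theorem angularSum_le_of_le {d M : ℕ} {c : ℝ} (hM : 3 ≤ M)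
    (h : ∀ x : Fin M → EuclideanSpace ℝ (Fin d), Function.Injective x →
      angularSum x ≤ c * ((M : ℝ) * ((M : ℝ) - 1) * ((M : ℝ) - 2)))
    {N : ℕ} (hN : M ≤ N) {x : Fin N → EuclideanSpace ℝ (Fin d)} (hx : Function.Injective x) :
    angularSum x ≤ c * ((N : ℝ) * ((N : ℝ) - 1) * ((N : ℝ) - 2)) := by
  induction N, hN using Nat.le_induction with
  | base => exact h x hx
  | succ N hN ih =>
    have hN3 : (3 : ℝ) ≤ N := by exact_mod_cast hM.trans hN
    have h1 : ((N : ℝ) - 2) * angularSum x ≤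
        (N + 1) * (c * ((N : ℝ) * ((N : ℝ) - 1) * ((N : ℝ) - 2))) := by
      rw [← sum_angularSum_succAbove]
      refine (Finset.sum_le_sum fun p _ => ih (hx.comp p.succAbove_right_injective)).trans ?_
      simp
    refine le_of_mul_le_mul_left (h1.trans_eq ?_) (show (0 : ℝ) < N - 2 by linarith)
    push_cast
    ring

theorem angularSum_le {d N : ℕ} (hN : 2 ≤ N) {x : Fin N → EuclideanSpace ℝ (Fin d)}
    (hx : Function.Injective x) :
    angularSum x ≤ 1 / 4 * ((N : ℝ) * ((N : ℝ) - 1) * ((N : ℝ) - 2)) := by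
  obtain rfl | hN := hN.eq_or_lt
  · simp [angularSum_two]
  · refine angularSum_le_of_le le_rfl (fun y hy => (angularSum_three_le hy).trans_eq ?_) hN hx
    norm_num

theorem angularValues_nonempty {d : ℕ} (hd : 2 ≤ d) (M : ℕ) : (angularValues d M).Nonempty := by
  have h0 : (EuclideanSpace.single (⟨0, by omega⟩ : Fin d) (1 : ℝ)) ≠ 0 := by simp
  refine ⟨_, fun i : Fin M => (i : ℝ) • EuclideanSpace.single (⟨0, by omega⟩ : Fin d) (1 : ℝ),
    fun i j hij => ?_, rfl⟩
  have := smul_left_injective ℝ h0 hij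
  exact Fin.ext (by exact_mod_cast this)

theorem isLUB_angularSup {d M : ℕ} (hd : 2 ≤ d) (hM : 2 ≤ M) :
    IsLUB (angularValues d M) (angularSup d M) := by
  refine isLUB_csSup (angularValues_nonempty hd M)
    ⟨1 / 4 * ((M : ℝ) * ((M : ℝ) - 1) * ((M : ℝ) - 2)), ?_⟩
  rintro _ ⟨x, hx, rfl⟩
  exact angularSum_le hM hx

theorem angularSup_le {d M : ℕ} (hd : 2 ≤ d) (hM : 2 ≤ M) :
    angularSup d M ≤ (M : ℝ) * ((M : ℝ) - 1) * ((M : ℝ) - 2) / 4 := by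
  refine (isLUB_angularSup hd hM).2 ?_
  rintro _ ⟨x, hx, rfl⟩
  exact (angularSum_le hM hx).trans_eq (by ring)

theorem alphaConst_le {d M : ℕ} (hd : 2 ≤ d) (hM : 3 ≤ M) : alphaConst d M ≤ 1 / 4 := by
  have hM' : (3 : ℝ) ≤ M := by exact_mod_cast hM
  have hpos : 0 < (M : ℝ) * ((M : ℝ) - 1) * ((M : ℝ) - 2) :=
    mul_pos (mul_pos (by linarith) (by linarith)) (by linarith)
  rw [alphaConst, div_le_iff₀ hpos]
  exact (angularSup_le hd (by omega)).trans_eq (by ring)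

theorem angularSum_le_alphaConst {d M N : ℕ} (hd : 2 ≤ d) (hM : 3 ≤ M) (hMN : M ≤ N)
    {x : Fin N → EuclideanSpace ℝ (Fin d)} (hx : Function.Injective x) :
    angularSum x ≤ alphaConst d M * ((N : ℝ) * ((N : ℝ) - 1) * ((N : ℝ) - 2)) := by
  refine angularSum_le_of_le hM (fun y hy => ?_) hMN hx
  have hM' : (3 : ℝ) ≤ M := by exact_mod_cast hM
  have hpos : 0 < (M : ℝ) * ((M : ℝ) - 1) * ((M : ℝ) - 2) :=
    mul_pos (mul_pos (by linarith) (by linarith)) (by linarith)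
  rw [alphaConst, div_mul_cancel₀ _ hpos.ne']
  exact (isLUB_angularSup hd (by omega)).1 ⟨y, hy, rfl⟩

/-- The value `3 / 2` is attained at an equilateral triangle. -/
theorem angularSup_three {d : ℕ} (hd : 2 ≤ d) : angularSup d 3 = 3 / 2 := by
  refine le_antisymm ((angularSup_le hd (by norm_num)).trans_eq (by norm_num)) ?_
  set a : EuclideanSpace ℝ (Fin d) := EuclideanSpace.single ⟨0, by omega⟩ 1 with ha
  set b : EuclideanSpace ℝ (Fin d) := EuclideanSpace.single ⟨1, by omega⟩ 1 with hb
  have haa : inner ℝ a a = 1 := by simp [ha]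
  have hbb : inner ℝ b b = 1 := by simp [hb]
  have hab : inner ℝ a b = 0 := by simp [ha, hb, EuclideanSpace.inner_single_left]
  have hba : inner ℝ b a = 0 := by rw [real_inner_comm, hab]
  have h3 : √3 * √3 = (3 : ℝ) := Real.mul_self_sqrt (by norm_num)
  set c : EuclideanSpace ℝ (Fin d) := (1 / 2 : ℝ) • a + (√3 / 2) • b with hc
  have n1 : ‖a‖ = 1 := by rw [norm_eq_sqrt_real_inner, haa, Real.sqrt_one]
  have n2 : ‖c‖ = 1 := by
    rw [norm_eq_sqrt_real_inner, Real.sqrt_eq_one]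
    simp only [hc, inner_add_left, inner_add_right, real_inner_smul_left, real_inner_smul_right,
      haa, hbb, hab, hba]
    linarith
  have n3 : ‖c - a‖ = 1 := by
    rw [norm_eq_sqrt_real_inner, Real.sqrt_eq_one]
    simp only [hc, inner_add_left, inner_add_right, inner_sub_left, inner_sub_right,
      real_inner_smul_left, real_inner_smul_right, haa, hbb, hab, hba]
    linarith
  have hne : ∀ {y z : EuclideanSpace ℝ (Fin d)}, ‖y - z‖ = 1 → y ≠ z := fun h e => by
    simp [e] at h
  have hinj : Function.Injective ![0, a, c] := by
    have h1 : a ≠ 0 := hne (by simpa using n1)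
    have h2 : c ≠ 0 := hne (by simpa using n2)
    have h3 := hne n3
    intro i j
    fin_cases i <;> fin_cases j <;> simp [h1, h2, h3, h1.symm, h2.symm, h3.symm]
  refine (isLUB_angularSup hd (by norm_num)).1 ⟨_, hinj, ?_⟩
  rw [angularSum_three]
  simp only [EuclideanGeometry.angle, InnerProductGeometry.cos_angle, vsub_eq_sub,
    Matrix.cons_val_zero, Matrix.cons_val_one, Matrix.cons_val, sub_zero, zero_sub, norm_neg,
    norm_sub_rev a c, n1, n2, n3]
  simp only [hc, inner_add_left, inner_add_right, inner_sub_right, inner_neg_left,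
      real_inner_smul_left, real_inner_smul_right, haa, hbb, hab, hba]
  linarith

/-! ### Weak derivatives of square integrable functions -/

section Algebra

variable {E F F' : Type*} [NormedAddCommGroup E] [NormedSpace ℝ E] [MeasurableSpace E]
  {μ : Measure E} [NormedAddCommGroup F] [NormedSpace ℝ F] [NormedAddCommGroup F']
  [NormedSpace ℝ F']

/-- `h` is the weak derivative of `u` in the direction `v`. -/
def HasWeakDirDeriv (μ : Measure E) (v : E) (u h : E → F) : Prop :=
  ∀ η : E → ℝ, ContDiff ℝ ∞ η → HasCompactSupport η →
    ∫ x, fderiv ℝ η x v • u x ∂μ = -∫ x, η x • h x ∂μ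

theorem integrable_fderiv_smul_of_hasCompactSupport [BorelSpace E] {η : E → ℝ}
    (hη : ContDiff ℝ ∞ η) (hη' : HasCompactSupport η) (v : E) {u : E → F}
    (hu : LocallyIntegrable u μ) : Integrable (fun x => fderiv ℝ η x v • u x) μ :=
  hu.integrable_smul_left_of_hasCompactSupport
    ((hη.continuous_fderiv (by simp)).clm_apply continuous_const) (hη'.fderiv_apply ℝ v)

theorem HasWeakDirDeriv.neg {v : E} {u h : E → F} (H : HasWeakDirDeriv μ v u h) :
    HasWeakDirDeriv μ (-v) u (-h) := fun η hη hη' => by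
  simpa [integral_neg, neg_eq_iff_eq_neg] using H η hη hη'

theorem HasWeakDirDeriv.sum [BorelSpace E] {ι : Type*} {s : Finset ι} {v : ι → E}
    {u : E → F} {h : ι → E → F}
    (H : ∀ i ∈ s, HasWeakDirDeriv μ (v i) u (h i)) (hu : LocallyIntegrable u μ)
    (hh : ∀ i ∈ s, LocallyIntegrable (h i) μ) :
    HasWeakDirDeriv μ (∑ i ∈ s, v i) u (∑ i ∈ s, h i) := fun η hη hη' => by
  simp only [map_sum, Finset.sum_smul, Finset.sum_apply, Finset.smul_sum]
  rw [integral_finsetSum _ fun i _ => integrable_fderiv_smul_of_hasCompactSupport hη hη' _ hu,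
    integral_finsetSum _ fun i hi =>
      (hh i hi).integrable_smul_left_of_hasCompactSupport hη.continuous hη',
    ← Finset.sum_neg_distrib]
  exact Finset.sum_congr rfl fun i hi => H i hi η hη hη'

theorem HasWeakDirDeriv.clm_comp [BorelSpace E] [CompleteSpace F] [CompleteSpace F'] {v : E}
    {u h : E → F} (H : HasWeakDirDeriv μ v u h) (hu : LocallyIntegrable u μ)
    (hh : LocallyIntegrable h μ) (L : F →L[ℝ] F') :
    HasWeakDirDeriv μ v (fun x => L (u x)) (fun x => L (h x)) := fun η hη hη' => by
  simp only [← map_smul]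
  rw [L.integral_comp_comm (integrable_fderiv_smul_of_hasCompactSupport hη hη' _ hu),
    L.integral_comp_comm (hh.integrable_smul_left_of_hasCompactSupport hη.continuous hη'),
    H η hη hη', map_neg]

end Algebra

section FiniteDimensional

variable {E : Type*} [NormedAddCommGroup E] [NormedSpace ℝ E] [FiniteDimensional ℝ E]
  [MeasurableSpace E] [BorelSpace E] {μ : Measure E} [μ.IsAddHaarMeasure]

/-- The derivative of `t ↦ ∫ η (x) u (t v + x) dx`, for a test function `η`. -/
theorem HasWeakDirDeriv.hasDerivAt_integral {v : E} {u h : E → ℝ} (H : HasWeakDirDeriv μ v u h)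
    (hu : LocallyIntegrable u μ) {η : E → ℝ} (hη : ContDiff ℝ ∞ η) (hη' : HasCompactSupport η)
    (s : ℝ) :
    HasDerivAt (fun t : ℝ => ∫ x, η x * u (t • v + x) ∂μ) (∫ x, η x * h (s • v + x) ∂μ) s := by
  have shift : ∀ (w : E → ℝ) (t : ℝ),
      ∫ x, η x * w (t • v + x) ∂μ = ∫ x, η (x - t • v) * w x ∂μ := fun w t => by
    rw [← integral_add_left_eq_self (fun x => η (x - t • v) * w x) (t • v)]
    simp
  have h1 : ∀ t : ℝ, ∫ x, η x * u (t • v + x) ∂μ =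
      convolution u (fun y => η (-y)) (ContinuousLinearMap.mul ℝ ℝ) μ (t • v) := fun t => by
    rw [shift, convolution_def]
    refine integral_congr_ae (.of_forall fun x => ?_)
    simp [mul_comm]
  have hneg : ContDiff ℝ 1 fun y => η (-y) := (hη.comp contDiff_neg).of_le (by simp)
  have hcneg : HasCompactSupport fun y => η (-y) :=
    hη'.comp_homeomorph (Homeomorph.neg E)
  -- The integral is a convolution with `η (-·)`, evaluated along the line `t v`.
  have h2 := hcneg.hasFDerivAt_convolution_right (ContinuousLinearMap.mul ℝ ℝ) hu hneg (s • v)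
  have h3 : HasDerivAt (fun t : ℝ => t • v) v s := by
    simpa using (hasDerivAt_id s).smul_const v
  have h4 := h2.comp_hasDerivAt s h3
  simp_rw [h1]
  convert! h4 using 1
  rw [convolution_precompR_apply _ hu (hcneg.fderiv ℝ) (hneg.continuous_fderiv one_ne_zero),
    convolution_def, shift]
  have hs : ∀ x, fderiv ℝ (fun y => η (y - s • v)) x = fderiv ℝ η (x - s • v) := fun x => by
    rw [fderiv_comp_sub]
  have H' := H (fun y => η (y - s • v)) (hη.comp (contDiff_id.sub contDiff_const))
    (hη'.comp_homeomorph (Homeomorph.subRight (s • v)))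
  simp only [smul_eq_mul] at H'
  rw [eq_neg_iff_add_eq_zero, add_comm, ← eq_neg_iff_add_eq_zero] at H'
  rw [H', ← integral_neg]
  refine integral_congr_ae (.of_forall fun x => ?_)
  have : fderiv ℝ (fun y => η (-y)) (s • v - x) = -fderiv ℝ η (x - s • v) := by
    have e : HasFDerivAt η (fderiv ℝ η (x - s • v)) (-(s • v - x)) := by
      rw [neg_sub]
      exact (hη.differentiable (by simp) _).hasFDerivAt
    refine ((e.comp (s • v - x) (hasFDerivAt_id _).neg).fderiv).trans ?_
    ext w
    simp
  simp [hs, this, mul_comm]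

/-- Translations are differentiable in `L²` on functions with a square integrable weak derivative.
Tested against a fixed `η`, the remainder `u (t v + ·) - u - t h` is controlled by the mean value
inequality and the continuity of `s ↦ h (s v + ·)`, with a constant proportional to `‖η‖₂`, so that
the density of the test functions in `L²` gives a bound in norm. -/
theorem HasWeakDirDeriv.hasDerivAt_vadd {v : E} {u h : Lp ℝ 2 μ} (H : HasWeakDirDeriv μ v u h) :
    HasDerivAt (fun t : ℝ => DomAddAct.mk (t • v) +ᵥ u) h 0 := by
  have : Fact ((2 : ENNReal) ≠ ⊤) := ⟨by simp⟩
  have hcont : Continuous fun t : ℝ => DomAddAct.mk (t • v) +ᵥ h :=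
    (DomAddAct.continuous_mk.comp (by fun_prop : Continuous fun t : ℝ => t • v)).vadd
      continuous_const
  have hcoe : ∀ (w : Lp ℝ 2 μ) (t : ℝ), ∀ {η : E → ℝ} {f : Lp ℝ 2 μ}, f =ᵐ[μ] η →
      inner ℝ f (DomAddAct.mk (t • v) +ᵥ w) = ∫ x, η x * w (t • v + x) ∂μ := by
    intro w t η f hf
    rw [L2.inner_def]
    refine integral_congr_ae ?_
    filter_upwards [hf, DomAddAct.vadd_Lp_ae_eq (DomAddAct.mk (t • v)) w] with x h1 h2
    rw [h1, h2]
    simp [mul_comm]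
  have hbound : ∀ {t K : ℝ}, (∀ s : ℝ, |s| ≤ |t| → ‖(DomAddAct.mk (s • v) +ᵥ h) - h‖ ≤ K) →
      ‖(DomAddAct.mk (t • v) +ᵥ u) - u - t • h‖ ≤ K * |t| := by
    intro t K hK
    set r := (DomAddAct.mk (t • v) +ᵥ u) - u - t • h with hr
    have hdense : ∀ f : Lp ℝ 2 μ, inner ℝ f r ≤ K * |t| * ‖f‖ := by
      intro f
      refine (Lp.dense_hasCompactSupport_contDiff (F := ℝ) (μ := μ) (p := 2) (by simp)).induction
        (P := fun f => inner ℝ f r ≤ K * |t| * ‖f‖) ?_ ?_ f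
      · rintro f ⟨η, hf, hη', hη⟩
        have hd : ∀ s : ℝ, HasDerivAt (fun s : ℝ => inner ℝ f
            ((DomAddAct.mk (s • v) +ᵥ u) - s • h))
            (inner ℝ f ((DomAddAct.mk (s • v) +ᵥ h) - h)) s := fun s => by
          have h1 := H.hasDerivAt_integral
            ((Lp.memLp u).locallyIntegrable one_le_two) hη hη' s
          simp_rw [← hcoe _ _ hf] at h1
          simp_rw [inner_sub_right, inner_smul_right]
          refine h1.sub ?_
          simpa using (hasDerivAt_id s).mul_const (inner ℝ f h)
        have hmv := (convex_Icc (-|t|) |t|).norm_image_sub_le_of_norm_hasDerivWithin_le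
          (C := ‖f‖ * K) (fun s _ => (hd s).hasDerivWithinAt) (fun s hs => by
            refine (norm_inner_le_norm _ _).trans ?_
            gcongr
            exact hK s (abs_le.2 hs))
          (x := 0) (y := t) (by simp) (abs_le.1 le_rfl)
        have h0 : DomAddAct.mk ((0 : ℝ) • v) +ᵥ u = u := by simp
        rw [h0, ← inner_sub_right] at hmv
        refine (le_abs_self _).trans (le_trans (le_of_eq ?_) (hmv.trans_eq ?_))
        · rw [hr, Real.norm_eq_abs]
          congr 2
          simp; abel
        · simp; ring
      · exact isClosed_le (by fun_prop) (by fun_prop)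
    -- The bound on the functional `⟪·, r⟫`, applied to `r` itself, is a bound on `‖r‖`.
    have := hdense r
    rw [real_inner_self_eq_norm_sq, sq] at this
    obtain h0 | h0 := (norm_nonneg r).eq_or_lt
    · rw [← h0]
      exact mul_nonneg ((norm_nonneg _).trans (hK 0 (by simp))) (abs_nonneg t)
    · exact le_of_mul_le_mul_right this h0
  rw [hasDerivAt_iff_isLittleO, Asymptotics.isLittleO_iff]
  intro c hc
  have hlim : ∀ᶠ s : ℝ in 𝓝 0, ‖(DomAddAct.mk (s • v) +ᵥ h) - h‖ < c := by
    have h1 : ContinuousAt (fun s : ℝ => ‖(DomAddAct.mk (s • v) +ᵥ h) - h‖) 0 :=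
      (hcont.sub continuous_const).norm.continuousAt
    refine h1.eventually_lt_const ?_
    simpa using hc
  obtain ⟨δ, hδ, hlim⟩ := Metric.eventually_nhds_iff.1 hlim
  refine Metric.eventually_nhds_iff.2 ⟨δ, hδ, fun t ht => ?_⟩
  simp only [zero_smul, sub_zero, DomAddAct.mk_zero, zero_vadd]
  refine hbound fun s hs => (hlim ?_).le
  rw [dist_zero_right] at ht ⊢
  exact hs.trans_lt ht

/-- Integration by parts against the square of an `H¹` function. -/
theorem HasWeakDirDeriv.integral_fderiv_mul_sq {v : E} {u h : E → ℝ} (H : HasWeakDirDeriv μ v u h)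
    (hu : MemLp u 2 μ) (hh : MemLp h 2 μ) {g : E → ℝ} (hg : ContDiff ℝ 1 g) {C C' : ℝ}
    (hC : ∀ x, |g x| ≤ C) (hC' : ∀ x, |fderiv ℝ g x v| ≤ C') :
    ∫ x, fderiv ℝ g x v * u x ^ 2 ∂μ = -(2 * ∫ x, g x * (u x * h x) ∂μ) := by
  have hgL : MemLp g ⊤ μ := memLp_top_of_bound hg.continuous.aestronglyMeasurable C (.of_forall hC)
  set U := hu.toLp
  set V := hh.toLp
  have hU : U =ᵐ[μ] u := hu.coeFn_toLp
  have hV : V =ᵐ[μ] h := hh.coeFn_toLp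
  have H' : HasWeakDirDeriv μ v U V := fun η hη hη' => by
    have H := H η hη hη'
    simp only [smul_eq_mul] at H ⊢
    rw [integral_congr_ae (hU.mono fun x hx => by rw [hx]), H,
      integral_congr_ae (f := fun x => η x * h x) (hV.symm.mono fun x hx =>
        congrArg (η x * ·) hx)]
  -- Multiplication by `g`, as a bounded operator on `L²`.
  let m : Lp ℝ 2 μ →L[ℝ] Lp ℝ 2 μ :=
    (ContinuousLinearMap.mul ℝ ℝ).holderL μ ⊤ 2 2 hgL.toLp
  have hm : ∀ f f' : Lp ℝ 2 μ, inner ℝ (m f) f' = ∫ x, g x * (f x * f' x) ∂μ := fun f f' => by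
    rw [L2.inner_def]
    refine integral_congr_ae ?_
    filter_upwards [(ContinuousLinearMap.mul ℝ ℝ).coeFn_holder (r := 2) hgL.toLp f,
      hgL.coeFn_toLp] with x h1 h2
    change inner ℝ ((ContinuousLinearMap.mul ℝ ℝ).holder 2 hgL.toLp f x) (f' x) = _
    rw [h1, ContinuousLinearMap.mul_apply', h2]
    simp
    ring
  have hd := H'.hasDerivAt_vadd
  -- The function `t ↦ ∫ g (x) u (t v + x)² dx` is differentiated as a quadratic form in `h1` and,
  -- after a translation of the variable of integration, under the integral sign in `h3`.
  have h1 := (m.hasFDerivAt.comp_hasDerivAt 0 hd).inner ℝ hd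
  have h2 : ∀ t : ℝ, inner ℝ (m (DomAddAct.mk (t • v) +ᵥ U)) (DomAddAct.mk (t • v) +ᵥ U) =
      ∫ x, g (x - t • v) * u x ^ 2 ∂μ := fun t => by
    rw [hm, ← integral_add_left_eq_self (fun x => g (x - t • v) * u x ^ 2) (t • v)]
    refine integral_congr_ae ?_
    filter_upwards [DomAddAct.vadd_Lp_ae_eq (DomAddAct.mk (t • v)) U,
      (measurePreserving_add_left μ (t • v)).quasiMeasurePreserving.ae_eq_comp hU] with x h3 h4
    simp only [Function.comp_apply] at h4
    rw [h3]
    simp [h4, sq]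
  have hsq : Integrable (fun x => u x ^ 2) μ := hu.integrable_sq
  have h3 := (hasDerivAt_integral_of_dominated_loc_of_deriv_le (μ := μ) (x₀ := (0 : ℝ))
    (F := fun t x => g (x - t • v) * u x ^ 2)
    (F' := fun t x => -(fderiv ℝ g (x - t • v) v) * u x ^ 2) (bound := fun x => C' * u x ^ 2)
    univ_mem (.of_forall fun t => ?_) ?_ ?_ (.of_forall fun x t _ => ?_) (hsq.const_mul C')
    (.of_forall fun x t _ => ?_)).2
  · simp only [Function.comp_apply, h2] at h1
    have := h1.unique h3
    simp only [zero_smul, DomAddAct.mk_zero, zero_vadd, hm, sub_zero] at this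
    rw [integral_congr_ae (g := fun x => g x * (u x * h x)) (by
      filter_upwards [hU, hV] with x h4 h5; rw [h4, h5]),
      integral_congr_ae (f := fun x => g x * (V x * U x)) (g := fun x => g x * (u x * h x)) (by
      filter_upwards [hU, hV] with x h4 h5; rw [h4, h5, mul_comm (h x)])] at this
    simp only [neg_mul, integral_neg] at this
    linarith
  · exact (hg.continuous.comp (by fun_prop)).aestronglyMeasurable.mul hsq.1
  · simp only [zero_smul, sub_zero]
    exact hsq.bdd_mul hg.continuous.aestronglyMeasurable (.of_forall hC)
  · simp only [zero_smul, sub_zero]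
    exact (((hg.continuous_fderiv one_ne_zero).clm_apply
      continuous_const).neg.aestronglyMeasurable).mul hsq.1
  · rw [norm_mul, norm_neg, Real.norm_eq_abs, Real.norm_of_nonneg (sq_nonneg _)]
    gcongr
    exact hC' _
  · refine HasDerivAt.mul_const ?_ _
    have e1 : HasDerivAt (fun t : ℝ => x - t • v) (-v) t := by
      simpa using ((hasDerivAt_id t).smul_const v).const_sub x
    have e2 := ((hg.differentiable one_ne_zero (x - t • v)).hasFDerivAt).comp_hasDerivAt t e1
    simpa [Function.comp_def] using e2

/-- Completing the square in `∫ (h - g u)² ≥ 0`. -/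
theorem HasWeakDirDeriv.integral_mul_sq_le {v : E} {u h : E → ℝ} (H : HasWeakDirDeriv μ v u h)
    (hu : MemLp u 2 μ) (hh : MemLp h 2 μ) {g : E → ℝ} (hg : ContDiff ℝ 1 g) {C C' : ℝ}
    (hC : ∀ x, |g x| ≤ C) (hC' : ∀ x, |fderiv ℝ g x v| ≤ C') :
    ∫ x, (-fderiv ℝ g x v - g x ^ 2) * u x ^ 2 ∂μ ≤ ∫ x, h x ^ 2 ∂μ := by
  have h1 := H.integral_fderiv_mul_sq hu hh hg hC hC'
  have h0 : 0 ≤ ∫ x, (h x - g x * u x) ^ 2 ∂μ := integral_nonneg fun x => sq_nonneg _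
  have i1 : Integrable (fun x => fderiv ℝ g x v * u x ^ 2) μ :=
    hu.integrable_sq.bdd_mul
      ((hg.continuous_fderiv one_ne_zero).clm_apply continuous_const).aestronglyMeasurable
      (.of_forall hC')
  have i2 : Integrable (fun x => g x * (u x * h x)) μ :=
    (hu.integrable_mul hh).bdd_mul hg.continuous.aestronglyMeasurable (.of_forall hC)
  have i3 : Integrable (fun x => g x ^ 2 * u x ^ 2) μ := by
    refine hu.integrable_sq.bdd_mul (c := C ^ 2) (hg.continuous.pow 2).aestronglyMeasurable
      (.of_forall fun x => ?_)
    rw [norm_pow, Real.norm_eq_abs]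
    gcongr
    exact hC x
  have i4 := hh.integrable_sq
  have e1 : ∫ x, (h x - g x * u x) ^ 2 ∂μ = ∫ x, h x ^ 2 ∂μ - 2 * ∫ x, g x * (u x * h x) ∂μ +
      ∫ x, g x ^ 2 * u x ^ 2 ∂μ := by
    have i5 : Integrable (fun x => h x ^ 2 - 2 * (g x * (u x * h x))) μ := i4.sub (i2.const_mul 2)
    rw [← integral_const_mul, ← integral_sub i4 (i2.const_mul 2), ← integral_add i5 i3]
    refine integral_congr_ae (.of_forall fun x => ?_)
    simp only
    ring
  have e2 : ∫ x, (-fderiv ℝ g x v - g x ^ 2) * u x ^ 2 ∂μ =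
      -∫ x, fderiv ℝ g x v * u x ^ 2 ∂μ - ∫ x, g x ^ 2 * u x ^ 2 ∂μ := by
    have i5 : Integrable (fun x => -(fderiv ℝ g x v * u x ^ 2)) μ := i1.neg
    rw [← integral_neg, ← integral_sub i5 i3]
    refine integral_congr_ae (.of_forall fun x => ?_)
    simp only
    ring
  linarith

/-- The inequality of `HasWeakDirDeriv.integral_mul_sq_le` for complex-valued functions. -/
theorem HasWeakDirDeriv.integral_mul_norm_sq_le {v : E} {ψ h : E → ℂ}
    (H : HasWeakDirDeriv μ v ψ h) (hψ : MemLp ψ 2 μ) (hh : MemLp h 2 μ) {g : E → ℝ}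
    (hg : ContDiff ℝ 1 g) {C C' : ℝ} (hC : ∀ x, |g x| ≤ C) (hC' : ∀ x, |fderiv ℝ g x v| ≤ C') :
    Integrable (fun x => (-fderiv ℝ g x v - g x ^ 2) * ‖ψ x‖ ^ 2) μ ∧
      ∫ x, (-fderiv ℝ g x v - g x ^ 2) * ‖ψ x‖ ^ 2 ∂μ ≤ ∫ x, ‖h x‖ ^ 2 ∂μ := by
  have lψ := hψ.locallyIntegrable one_le_two
  have lh := hh.locallyIntegrable one_le_two
  have mre : ∀ f : E → ℂ, MemLp f 2 μ → MemLp (fun x => Complex.reCLM (f x)) 2 μ :=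
    fun f hf => hf.re
  have mim : ∀ f : E → ℂ, MemLp f 2 μ → MemLp (fun x => Complex.imCLM (f x)) 2 μ :=
    fun f hf => hf.im
  have hre := (H.clm_comp lψ lh Complex.reCLM).integral_mul_sq_le (mre ψ hψ) (mre h hh) hg hC hC'
  have him := (H.clm_comp lψ lh Complex.imCLM).integral_mul_sq_le (mim ψ hψ) (mim h hh) hg hC hC'
  have hint : ∀ u : E → ℝ, MemLp u 2 μ →
      Integrable (fun x => (-fderiv ℝ g x v - g x ^ 2) * u x ^ 2) μ := fun u hu => by
    refine hu.integrable_sq.bdd_mul (c := C' + C ^ 2)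
      (((hg.continuous_fderiv one_ne_zero).clm_apply continuous_const).neg.sub
        (hg.continuous.pow 2)).aestronglyMeasurable (.of_forall fun x => ?_)
    refine (norm_sub_le _ _).trans ?_
    rw [norm_neg, norm_pow, Real.norm_eq_abs, Real.norm_eq_abs]
    gcongr
    · exact hC' x
    · exact hC x
  have hsq : ∀ z : ℂ, ‖z‖ ^ 2 = Complex.reCLM z ^ 2 + Complex.imCLM z ^ 2 := fun z => by
    rw [Complex.sq_norm, Complex.normSq_apply]
    simp [sq]
  refine ⟨hint _ hψ.norm, ?_⟩
  simp only [hsq, mul_add]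
  rw [integral_add (hint _ (mre ψ hψ)) (hint _ (mim ψ hψ)),
    integral_add (mre h hh).integrable_sq (mim h hh).integrable_sq]
  exact add_le_add hre him

end FiniteDimensional

/-! ### The regularised Coulomb field -/

/-- The regularisation `√(‖y‖² + ε²)` of the norm. -/
noncomputable def softNorm {V : Type*} [NormedAddCommGroup V] (ε : ℝ) (y : V) : ℝ :=
  √(‖y‖ ^ 2 + ε ^ 2)

section SoftNorm

variable {V : Type*} [NormedAddCommGroup V]

theorem norm_le_softNorm (ε : ℝ) (y : V) : ‖y‖ ≤ softNorm ε y :=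
  Real.le_sqrt_of_sq_le (by nlinarith [sq_nonneg ε])

theorem softNorm_zero (y : V) : softNorm 0 y = ‖y‖ := by
  simp [softNorm]

theorem softNorm_nonneg (ε : ℝ) (y : V) : 0 ≤ softNorm ε y := Real.sqrt_nonneg _

theorem softNorm_pos {ε : ℝ} (hε : ε ≠ 0) (y : V) : 0 < softNorm ε y := by
  have := sq_pos_of_ne_zero hε
  exact Real.sqrt_pos.2 (by positivity)

theorem le_softNorm (ε : ℝ) (y : V) : ε ≤ softNorm ε y :=
  Real.le_sqrt_of_sq_le (by nlinarith [sq_nonneg ‖y‖])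

theorem continuous_softNorm_left (y : V) : Continuous fun ε => softNorm ε y := by
  unfold softNorm; fun_prop

theorem contDiff_softNorm [InnerProductSpace ℝ V] {ε : ℝ} (hε : ε ≠ 0) {m : WithTop ℕ∞} :
    ContDiff ℝ m (softNorm (V := V) ε) :=
  ((contDiff_norm_sq ℝ).add contDiff_const).sqrt fun _ =>
    (add_pos_of_nonneg_of_pos (sq_nonneg _) (sq_pos_of_ne_zero hε)).ne'

end SoftNorm

section SoftUnit

variable {d : ℕ}

theorem contDiff_softUnit {ε : ℝ} (hε : ε ≠ 0) (a : Fin d) {m : WithTop ℕ∞} :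
    ContDiff ℝ m fun y : EuclideanSpace ℝ (Fin d) => (softNorm ε y)⁻¹ * y a :=
  ((contDiff_softNorm hε).inv fun y => (softNorm_pos hε y).ne').mul (by fun_prop)

theorem abs_softUnit_le (ε : ℝ) (a : Fin d) (y : EuclideanSpace ℝ (Fin d)) :
    |(softNorm ε y)⁻¹ * y a| ≤ 1 := by
  rw [abs_mul, abs_inv, abs_of_nonneg (softNorm_nonneg ε y)]
  refine inv_mul_le_one_of_le₀ ?_ (softNorm_nonneg ε y)
  exact (PiLp.norm_apply_le y a).trans (norm_le_softNorm ε y)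

/-- The `a`-th partial derivative of the `a`-th component of `y / √(‖y‖² + ε²)`. -/
theorem fderiv_softUnit {ε : ℝ} (hε : ε ≠ 0) (a : Fin d) (y : EuclideanSpace ℝ (Fin d)) :
    fderiv ℝ (fun y : EuclideanSpace ℝ (Fin d) => (softNorm ε y)⁻¹ * y a) y
      (EuclideanSpace.single a 1) = (softNorm ε y)⁻¹ - y a ^ 2 * (softNorm ε y)⁻¹ ^ 3 := by
  set e : EuclideanSpace ℝ (Fin d) := EuclideanSpace.single a 1 with he
  have hs := softNorm_pos hε y
  have hline : HasDerivAt (fun t : ℝ => y + t • e) e 0 := by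
    simpa using ((hasDerivAt_id (0 : ℝ)).smul_const e).const_add y
  have h1 : HasDerivAt (fun t : ℝ => softNorm ε (y + t • e)) (y a / softNorm ε y) 0 := by
    have h2 := (hline.norm_sq.add_const (ε ^ 2)).sqrt (by simp only [zero_smul]; positivity)
    convert! h2 using 1
    simp only [zero_smul, add_zero, softNorm, he, EuclideanSpace.inner_single_right]
    simp only [conj_trivial]
    field_simp
  have h3 : HasDerivAt (fun t : ℝ => (y + t • e) a) 1 0 := by
    have : (fun t : ℝ => (y + t • e) a) = fun t => y a + t := by
      ext t; simp [he]
    rw [this]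
    exact (hasDerivAt_id (0 : ℝ)).const_add (y a)
  have h4 := (h1.inv (by simpa using hs.ne')).mul h3
  have h5 : HasDerivAt (fun t : ℝ => (softNorm ε (y + t • e))⁻¹ * (y + t • e) a)
      (fderiv ℝ (fun y : EuclideanSpace ℝ (Fin d) => (softNorm ε y)⁻¹ * y a) y e) 0 := by
    have hd := ((contDiff_softUnit hε a (m := 1)).differentiable one_ne_zero y).hasFDerivAt
    have hd' : HasFDerivAt (fun y : EuclideanSpace ℝ (Fin d) => (softNorm ε y)⁻¹ * y a)
      (fderiv ℝ (fun y : EuclideanSpace ℝ (Fin d) => (softNorm ε y)⁻¹ * y a) y)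
      (y + (0 : ℝ) • e) := by simpa using hd
    exact hd'.comp_hasDerivAt 0 hline
  rw [h5.unique h4]
  simp only [zero_smul, add_zero, Pi.inv_apply]
  field_simp
  ring

theorem fderiv_softUnit_mem_Icc {ε : ℝ} (hε : ε ≠ 0) (a : Fin d)
    (y : EuclideanSpace ℝ (Fin d)) :
    fderiv ℝ (fun y : EuclideanSpace ℝ (Fin d) => (softNorm ε y)⁻¹ * y a) y
      (EuclideanSpace.single a 1) ∈ Set.Icc 0 (softNorm ε y)⁻¹ := by
  rw [fderiv_softUnit hε]
  have hs := softNorm_pos hε y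
  have h1 : (y a * (softNorm ε y)⁻¹) ^ 2 ≤ 1 := by
    rw [mul_comm, sq_le_one_iff_abs_le_one]
    exact abs_softUnit_le ε a y
  have h2 : y a ^ 2 * (softNorm ε y)⁻¹ ^ 3 = (y a * (softNorm ε y)⁻¹) ^ 2 * (softNorm ε y)⁻¹ := by
    ring
  have h3 := inv_pos.2 hs
  rw [h2]
  constructor
  · nlinarith
  · have := mul_nonneg (sq_nonneg (y a * (softNorm ε y)⁻¹)) h3.le
    linarith

/-- The divergence of `y / √(‖y‖² + ε²)` is at least `(d - 1) / √(‖y‖² + ε²)`. -/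
theorem le_sum_fderiv_softUnit {ε : ℝ} (hε : ε ≠ 0) (y : EuclideanSpace ℝ (Fin d)) :
    ((d : ℝ) - 1) * (softNorm ε y)⁻¹ ≤
      ∑ a, fderiv ℝ (fun y : EuclideanSpace ℝ (Fin d) => (softNorm ε y)⁻¹ * y a) y
        (EuclideanSpace.single a 1) := by
  have hs := softNorm_pos hε y
  simp only [fderiv_softUnit hε]
  rw [Finset.sum_sub_distrib, ← Finset.sum_mul, ← EuclideanSpace.real_norm_sq_eq]
  simp only [Finset.sum_const, Finset.card_univ, Fintype.card_fin, nsmul_eq_mul]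
  have h1 : (‖y‖ * (softNorm ε y)⁻¹) ^ 2 ≤ 1 := by
    rw [sq_le_one_iff₀ (by positivity)]
    exact mul_inv_le_one_of_le₀ (norm_le_softNorm ε y) hs.le
  have h2 := mul_le_mul_of_nonneg_right h1 (inv_pos.2 hs).le
  nlinarith

end SoftUnit

/-! ### Relative positions -/

section Positions

variable {d n : ℕ}

/-- The position of the `j`-th particle relative to the `i`-th one, as a linear function of the
relative coordinates. -/
noncomputable def relPos (i j : Fin (n + 1)) : RelConfig d n →L[ℝ] EuclideanSpace ℝ (Fin d) :=
  let p : Fin (n + 1) → RelConfig d n →L[ℝ] EuclideanSpace ℝ (Fin d) :=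
    Fin.cons 0 fun k => ContinuousLinearMap.proj k
  p j - p i

theorem relPos_apply (i j : Fin (n + 1)) (q : RelConfig d n) :
    relPos i j q = positions q j - positions q i := by
  have h : ∀ j, (Fin.cons 0 (fun k => ContinuousLinearMap.proj k) :
      Fin (n + 1) → RelConfig d n →L[ℝ] EuclideanSpace ℝ (Fin d)) j q = positions q j := fun j => by
    refine Fin.cases ?_ (fun k => ?_) j <;> simp [positions]
  simp only [relPos, sub_apply, h]

@[simp]
theorem relPos_self (i : Fin (n + 1)) : relPos (d := d) i i = 0 := sub_self _

/-- The displacement of the relative coordinates when the `i`-th particle is moved by `y`. -/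
def particleShift (i : Fin (n + 1)) (y : EuclideanSpace ℝ (Fin d)) : RelConfig d n :=
  Fin.cases (motive := fun _ => RelConfig d n) (-∑ k, Pi.single k y) (fun k => Pi.single k y) i

theorem relPos_particleShift {i j : Fin (n + 1)} (h : j ≠ i) (y : EuclideanSpace ℝ (Fin d)) :
    relPos i j (particleShift i y) = -y := by
  rw [relPos_apply]
  have hs : ∀ k : Fin n, (∑ l, Pi.single (M := fun _ => EuclideanSpace ℝ (Fin d)) l y) k = y :=
    fun k => by simp [Finset.sum_apply, Pi.single_apply]
  revert h
  refine Fin.cases ?_ (fun k => ?_) i <;> refine Fin.cases ?_ (fun l => ?_) j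
  · simp
  · intro _
    simp [positions, particleShift, hs]
  · intro _
    simp [positions, particleShift]
  · intro h
    have : l ≠ k := fun e => h (by rw [e])
    simp [positions, particleShift, this]

/-- Almost every configuration consists of distinct points. -/
theorem ae_injective_positions (hd : 0 < d) :
    ∀ᵐ q : RelConfig d n, Function.Injective (positions q) := by
  have h : ∀ i j : Fin (n + 1), j ≠ i → ∀ᵐ q : RelConfig d n, relPos i j q ≠ 0 := by
    intro i j hij
    have hker : (relPos (d := d) i j).ker ≠ ⊤ := fun h => by
      have h1 : particleShift i (EuclideanSpace.single (⟨0, hd⟩ : Fin d) (1 : ℝ)) ∈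
          (relPos (d := d) i j).ker := h ▸ Submodule.mem_top
      rw [LinearMap.mem_ker, ContinuousLinearMap.coe_coe, relPos_particleShift hij] at h1
      simp at h1
    exact measure_eq_zero_iff_ae_notMem.1 (Measure.addHaar_submodule volume _ hker)
  have h' : ∀ᵐ q : RelConfig d n, ∀ i j : Fin (n + 1), j ≠ i → relPos i j q ≠ 0 := by
    simp only [ae_all_iff]
    exact h
  filter_upwards [h'] with q hq i j hij
  by_contra hne
  exact hq j i hne (by rw [relPos_apply, hij, sub_self])

end Positions

/-! ### The Coulomb field of a configuration -/

theorem sum_sum_eq_sum_diag_add_two_mul {N : ℕ} {c : Fin N → Fin N → ℝ}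
    (hc : ∀ i j, c i j = c j i) :
    ∑ i, ∑ j, c i j = ∑ i, c i i + 2 * ∑ i, ∑ j, if i < j then c i j else 0 := by
  have h : ∀ i j, c i j = (if i = j then c i i else 0) + (if i < j then c i j else 0) +
      (if j < i then c j i else 0) := fun i j => by
    rcases lt_trichotomy i j with h | rfl | h
    · simp [h, h.ne, h.not_gt]
    · simp
    · simp [h, h.ne', h.not_gt, hc i j]
  rw [Finset.sum_congr rfl fun i _ => Finset.sum_congr rfl fun j _ => h i j]
  simp only [Finset.sum_add_distrib, Finset.sum_ite_eq, Finset.mem_univ, if_true]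
  rw [Finset.sum_comm (f := fun i j => if j < i then c j i else 0)]
  ring

/-- At each vertex, the square of the sum of the unit vectors towards the other points is the number
of these points plus twice the cosines of the angles they make. -/
theorem sum_norm_sum_unit_sq {d N : ℕ} {x : Fin N → EuclideanSpace ℝ (Fin d)}
    (hx : Function.Injective x) :
    ∑ i, ‖∑ j, ‖x j - x i‖⁻¹ • (x j - x i)‖ ^ 2 =
      (N : ℝ) * ((N : ℝ) - 1) + 2 * angularSum x := by
  have h : ∀ i, ‖∑ j, ‖x j - x i‖⁻¹ • (x j - x i)‖ ^ 2 = ((N : ℝ) - 1) + 2 * ∑ j, ∑ k,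
      if j < k ∧ j ≠ i ∧ k ≠ i then Real.cos (EuclideanGeometry.angle (x j) (x i) (x k))
      else 0 := by
    intro i
    rw [← real_inner_self_eq_norm_sq, sum_inner]
    simp_rw [inner_sum]
    rw [sum_sum_eq_sum_diag_add_two_mul fun j k => real_inner_comm _ _]
    congr 1
    · have h1 : ∀ j, inner ℝ (‖x j - x i‖⁻¹ • (x j - x i)) (‖x j - x i‖⁻¹ • (x j - x i)) =
          (1 : ℝ) - if j = i then 1 else 0 := fun j => by
        rw [real_inner_self_eq_norm_sq, norm_smul, norm_inv, norm_norm]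
        by_cases hj : j = i
        · simp [hj]
        · rw [inv_mul_cancel₀ (norm_ne_zero_iff.2 (sub_ne_zero.2 (hx.ne hj)))]
          simp [hj]
      rw [Finset.sum_congr rfl fun j _ => h1 j]
      simp
    · congr 1
      refine Finset.sum_congr rfl fun j _ => Finset.sum_congr rfl fun k _ => ?_
      by_cases hj : j = i
      · simp [hj]
      by_cases hk : k = i
      · simp [hk]
      simp only [hj, hk, ne_eq, not_false_eq_true, and_true, EuclideanGeometry.angle,
        InnerProductGeometry.cos_angle, vsub_eq_sub, real_inner_smul_left, real_inner_smul_right]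
      congr 1
      rw [div_eq_mul_inv, mul_inv]
      ring
  rw [Finset.sum_congr rfl fun i _ => h i, Finset.sum_add_distrib, ← Finset.mul_sum]
  simp only [angularSum, Finset.sum_const, Finset.card_univ, Fintype.card_fin, nsmul_eq_mul]

section Field

variable {d n : ℕ}

/-- The `a`-th component of the field at the `i`-th particle: the sum of the regularised unit
vectors pointing to the particles. The term `j = i` vanishes. -/
noncomputable def softField (ε : ℝ) (i : Fin (n + 1)) (a : Fin d) (q : RelConfig d n) : ℝ :=
  ∑ j, (softNorm ε (relPos i j q))⁻¹ * relPos i j q a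

theorem contDiff_softField {ε : ℝ} (hε : ε ≠ 0) (i : Fin (n + 1)) (a : Fin d)
    {m : WithTop ℕ∞} : ContDiff ℝ m (softField (n := n) ε i a) :=
  ContDiff.sum fun j _ => (contDiff_softUnit hε a).comp (relPos i j).contDiff

theorem abs_softField_le (ε : ℝ) (i : Fin (n + 1)) (a : Fin d) (q : RelConfig d n) :
    |softField ε i a q| ≤ n + 1 := by
  refine (Finset.abs_sum_le_sum_abs _ _).trans
    ((Finset.sum_le_sum fun j _ => abs_softUnit_le ε a _).trans_eq ?_)
  simp

theorem fderiv_softField {ε : ℝ} (hε : ε ≠ 0) (i : Fin (n + 1)) (a : Fin d)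
    (q : RelConfig d n) :
    fderiv ℝ (softField ε i a) q (particleShift i (EuclideanSpace.single a 1)) =
      -∑ j ∈ Finset.univ.erase i,
        fderiv ℝ (fun y : EuclideanSpace ℝ (Fin d) => (softNorm ε y)⁻¹ * y a) (relPos i j q)
          (EuclideanSpace.single a 1) := by
  set f := fun y : EuclideanSpace ℝ (Fin d) => (softNorm ε y)⁻¹ * y a with hf
  have hd : ∀ j, HasFDerivAt (fun q : RelConfig d n => f (relPos i j q))
      ((fderiv ℝ f (relPos i j q)).comp (relPos i j)) q := fun j =>
    ((contDiff_softUnit hε a (m := 1)).differentiable one_ne_zero _).hasFDerivAt.comp q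
      (relPos i j).hasFDerivAt
  have hsum : HasFDerivAt (softField ε i a)
      (∑ j, (fderiv ℝ f (relPos i j q)).comp (relPos i j)) q := HasFDerivAt.fun_sum fun j _ => hd j
  rw [hsum.fderiv, sum_apply, ← Finset.add_sum_erase _ _ (Finset.mem_univ i),
    ← Finset.sum_neg_distrib]
  simp only [relPos_self, ContinuousLinearMap.comp_apply, zero_apply, map_zero, zero_add]
  refine Finset.sum_congr rfl fun j hj => ?_
  rw [relPos_particleShift (Finset.ne_of_mem_erase hj), map_neg]

theorem abs_fderiv_softField_le {ε : ℝ} (hε : 0 < ε) (i : Fin (n + 1)) (a : Fin d)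
    (q : RelConfig d n) :
    |fderiv ℝ (softField ε i a) q (particleShift i (EuclideanSpace.single a 1))| ≤
      (n + 1) * ε⁻¹ := by
  rw [fderiv_softField hε.ne', abs_neg]
  refine (Finset.abs_sum_le_sum_abs _ _).trans ?_
  refine (Finset.sum_le_sum_of_subset_of_nonneg (Finset.erase_subset _ _)
    fun _ _ _ => abs_nonneg _).trans ?_
  refine (Finset.sum_le_sum (g := fun _ => ε⁻¹) fun j _ => ?_).trans_eq (by simp)
  have h := fderiv_softUnit_mem_Icc hε.ne' a (relPos i j q)
  rw [abs_of_nonneg h.1]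
  exact h.2.trans (inv_anti₀ hε (le_softNorm ε _))

/-- The function `∑_{i ≠ j} 1 / r_{ij} - μ² ∑_i |G_i|²`, the sum being over ordered pairs, `r_{ij}`
the regularised distance and `G_i` the regularised field at the `i`-th particle. For
`μ = 1 / (d - 1)` it is a lower bound of `∑_i (- μ div_i G_i - μ² |G_i|²)`. -/
noncomputable def fieldBound (μ ε : ℝ) (q : RelConfig d n) : ℝ :=
  ∑ i : Fin (n + 1), ∑ j ∈ Finset.univ.erase i, (softNorm ε (relPos i j q))⁻¹ -
    μ ^ 2 * ∑ i : Fin (n + 1), ∑ a : Fin d, softField ε i a q ^ 2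

theorem fieldBound_le (hd : 2 ≤ d) {ε : ℝ} (hε : ε ≠ 0) (q : RelConfig d n) :
    fieldBound ((d : ℝ) - 1)⁻¹ ε q ≤ ∑ i : Fin (n + 1), ∑ a : Fin d,
      (-fderiv ℝ (fun q => ((d : ℝ) - 1)⁻¹ * softField ε i a q) q
        (particleShift i (EuclideanSpace.single a 1)) -
        (((d : ℝ) - 1)⁻¹ * softField ε i a q) ^ 2) := by
  have hd' : (0 : ℝ) < d - 1 := by
    have : (2 : ℝ) ≤ d := by exact_mod_cast hd
    linarith
  have hf : ∀ (i : Fin (n + 1)) (a : Fin d),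
      fderiv ℝ (fun q => ((d : ℝ) - 1)⁻¹ * softField ε i a q) q = ((d : ℝ) - 1)⁻¹ •
        fderiv ℝ (softField ε i a) q := fun i a =>
    fderiv_const_mul ((contDiff_softField hε i a (m := 1)).differentiable one_ne_zero q) _
  simp only [hf, smul_apply, fderiv_softField hε, smul_eq_mul, mul_neg, neg_neg,
    mul_pow, Finset.sum_sub_distrib, fieldBound, ← Finset.mul_sum]
  gcongr
  rw [Finset.mul_sum]
  refine Finset.sum_le_sum fun i _ => ?_
  rw [Finset.sum_comm, Finset.mul_sum]
  refine Finset.sum_le_sum fun j _ => ?_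
  rw [← div_eq_inv_mul, le_div_iff₀ hd', mul_comm]
  exact le_sum_fderiv_softUnit hε _

theorem sum_inv_norm_relPos (q : RelConfig d n) :
    ∑ i : Fin (n + 1), ∑ j ∈ Finset.univ.erase i, ‖relPos i j q‖⁻¹ =
      -(2 * coulombPotential q) := by
  have h1 : ∀ i : Fin (n + 1), ∑ j ∈ Finset.univ.erase i, ‖relPos i j q‖⁻¹ =
      ∑ j, ‖relPos i j q‖⁻¹ := fun i =>
    -- The diagonal term is `‖0‖⁻¹ = 0`.
    Finset.sum_erase _ (by simp)
  rw [Finset.sum_congr rfl fun i _ => h1 i, sum_sum_eq_sum_diag_add_two_mul fun i j => by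
    rw [relPos_apply, relPos_apply, norm_sub_rev]]
  simp only [relPos_self, zero_apply, norm_zero, inv_zero, Finset.sum_const_zero, zero_add,
    coulombPotential, relPos_apply]
  rw [← mul_neg, ← Finset.sum_neg_distrib]
  congr 1
  refine Finset.sum_congr rfl fun i _ => ?_
  rw [← Finset.sum_neg_distrib]
  refine Finset.sum_congr rfl fun j _ => ?_
  split_ifs <;> simp

theorem fieldBound_zero (μ : ℝ) {q : RelConfig d n} (hq : Function.Injective (positions q)) :
    fieldBound μ 0 q = -(2 * coulombPotential q) -
      μ ^ 2 * (((n + 1 : ℕ) : ℝ) * (((n + 1 : ℕ) : ℝ) - 1) + 2 * angularSum (positions q)) := by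
  rw [fieldBound, ← sum_norm_sum_unit_sq hq, ← sum_inv_norm_relPos]
  simp only [softNorm_zero]
  congr 2
  refine Finset.sum_congr rfl fun i _ => ?_
  rw [EuclideanSpace.real_norm_sq_eq]
  refine Finset.sum_congr rfl fun a _ => ?_
  simp [softField, softNorm_zero, relPos_apply]

theorem abs_fieldBound_le (μ ε : ℝ) {q : RelConfig d n} (hq : Function.Injective (positions q)) :
    |fieldBound μ ε q| ≤
      -(2 * coulombPotential q) + μ ^ 2 * (((n : ℝ) + 1) * (d * ((n : ℝ) + 1) ^ 2)) := by
  rw [← sum_inv_norm_relPos]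
  refine (abs_sub _ _).trans (add_le_add ?_ ?_)
  · rw [abs_of_nonneg (Finset.sum_nonneg fun i _ => Finset.sum_nonneg fun j _ =>
      inv_nonneg.2 (softNorm_nonneg _ _))]
    refine Finset.sum_le_sum fun i _ => Finset.sum_le_sum fun j hj => ?_
    refine inv_anti₀ (norm_pos_iff.2 ?_) (norm_le_softNorm _ _)
    rw [relPos_apply, sub_ne_zero]
    exact hq.ne (Finset.ne_of_mem_erase hj)
  · rw [abs_of_nonneg (by positivity)]
    gcongr
    refine (Finset.sum_le_sum (g := fun _ => (d : ℝ) * ((n : ℝ) + 1) ^ 2) fun i _ => ?_).trans_eq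
      (by simp)
    refine (Finset.sum_le_sum (g := fun _ => ((n : ℝ) + 1) ^ 2) fun a _ => ?_).trans_eq (by simp)
    rw [← sq_abs]
    gcongr
    exact abs_softField_le ε i a q

theorem ae_norm_fieldBound_mul_le (hd : 0 < d) (μ ε : ℝ) (ψ : RelConfig d n → ℂ) :
    ∀ᵐ q, ‖fieldBound μ ε q * ‖ψ q‖ ^ 2‖ ≤
      (-(2 * coulombPotential q) + μ ^ 2 * (((n : ℝ) + 1) * (d * ((n : ℝ) + 1) ^ 2))) *
        ‖ψ q‖ ^ 2 := by
  filter_upwards [ae_injective_positions (n := n) hd] with q hq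
  rw [norm_mul, Real.norm_of_nonneg (sq_nonneg ‖ψ q‖), Real.norm_eq_abs]
  gcongr
  exact abs_fieldBound_le μ ε hq

theorem continuous_fieldBound (μ : ℝ) {ε : ℝ} (hε : ε ≠ 0) :
    Continuous (fieldBound (d := d) (n := n) μ ε) := by
  unfold fieldBound
  refine .sub (continuous_finsetSum _ fun i _ => continuous_finsetSum _ fun j _ => ?_)
    (continuous_const.mul (continuous_finsetSum _ fun i _ => continuous_finsetSum _ fun a _ =>
      (contDiff_softField hε i a (m := 0)).continuous.pow 2))
  exact ((contDiff_softNorm hε (m := 0)).continuous.comp (relPos i j).continuous).inv₀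
    fun q => (softNorm_pos hε _).ne'

theorem continuousAt_fieldBound (μ : ℝ) {q : RelConfig d n}
    (hq : Function.Injective (positions q)) : ContinuousAt (fun ε => fieldBound μ ε q) 0 := by
  have h : ∀ i j : Fin (n + 1), j ≠ i →
      ContinuousAt (fun ε => (softNorm ε (relPos i j q))⁻¹) 0 := fun i j hij => by
    refine (continuous_softNorm_left _).continuousAt.inv₀ ?_
    rw [softNorm_zero, norm_ne_zero_iff, relPos_apply, sub_ne_zero]
    exact hq.ne hij
  unfold fieldBound softField
  refine .sub (tendsto_finsetSum _ fun i _ => tendsto_finsetSum _ fun j hj =>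
    h i j (Finset.ne_of_mem_erase hj)) (tendsto_const_nhds.mul
    (tendsto_finsetSum _ fun i _ => tendsto_finsetSum _ fun a _ =>
      Tendsto.pow (tendsto_finsetSum _ fun j _ => ?_) 2))
  by_cases hij : j = i
  · simp [hij]
  · exact (h i j hij).mul continuousAt_const

end Field

/-! ### The energy of a state -/

section Energy

variable {d n : ℕ} {ψ : RelConfig d n → ℂ} {G : Fin n → Fin d → RelConfig d n → ℂ}

theorem InFormDomain.memLp_particleGrad (H : InFormDomain ψ G) (i : Fin (n + 1)) (a : Fin d) :
    MemLp (particleGrad G i a) 2 := by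
  refine Fin.cases ?_ (fun k => ?_) i
  · exact (memLp_finsetSum Finset.univ fun k _ => H.memLp_grad k a).neg
  · exact H.memLp_grad k a

theorem InFormDomain.hasWeakDirDeriv (H : InFormDomain ψ G) (i : Fin (n + 1)) (a : Fin d) :
    HasWeakDirDeriv volume (particleShift i (EuclideanSpace.single a 1)) ψ
      (particleGrad G i a) := by
  refine Fin.cases ?_ (fun k => ?_) i
  · have h := (HasWeakDirDeriv.sum (s := Finset.univ) (fun k _ => H.weak_grad k a)
      (H.memLp.locallyIntegrable one_le_two)
      fun k _ => (H.memLp_grad k a).locallyIntegrable one_le_two).neg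
    convert! h using 1
    ext q
    simp [particleGrad]
  · exact H.weak_grad k a

/-- The integral `∑_i ∫ |∇_i ψ|²`, twice the kinetic energy of the state with gradient `G`. -/
noncomputable def kineticIntegral (G : Fin n → Fin d → RelConfig d n → ℂ) : ℝ :=
  ∑ i : Fin (n + 1), ∑ a : Fin d, ∫ q, ‖particleGrad G i a q‖ ^ 2

theorem energyForm_self (ψ : RelConfig d n → ℂ) (G : Fin n → Fin d → RelConfig d n → ℂ) :
    energyForm ψ G ψ G =
      ((1 / 2 * kineticIntegral G + ∫ q, coulombPotential q * ‖ψ q‖ ^ 2 : ℝ) : ℂ) := by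
  have h : ∀ z : ℂ, conj z * z = ((‖z‖ ^ 2 : ℝ) : ℂ) := fun z => by
    rw [Complex.conj_mul', Complex.ofReal_pow]
  simp only [energyForm, h, kineticIntegral, ← Complex.ofReal_mul, integral_complex_ofReal]
  push_cast
  rfl

theorem InFormDomain.integrable_potential_add_const_mul (H : InFormDomain ψ G) (c : ℝ) :
    Integrable fun q => (-(2 * coulombPotential q) + c) * ‖ψ q‖ ^ 2 := by
  have h := (H.integrable_potential.const_mul (-2)).add (H.memLp.norm.integrable_sq.const_mul c)
  refine h.congr (.of_forall fun q => ?_)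
  simp only [Pi.add_apply]
  ring

theorem InFormDomain.integral_fieldBound_le (hd : 2 ≤ d) (H : InFormDomain ψ G) {ε : ℝ}
    (hε : 0 < ε) : ∫ q, fieldBound ((d : ℝ) - 1)⁻¹ ε q * ‖ψ q‖ ^ 2 ≤ kineticIntegral G := by
  set μ : ℝ := ((d : ℝ) - 1)⁻¹ with hμ
  have key := fun (i : Fin (n + 1)) (a : Fin d) =>
    (H.hasWeakDirDeriv i a).integral_mul_norm_sq_le H.memLp (H.memLp_particleGrad i a)
      (g := fun q => μ * softField ε i a q) (C := |μ| * (n + 1)) (C' := |μ| * ((n + 1) * ε⁻¹))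
      (contDiff_const.mul (contDiff_softField hε.ne' i a))
      (fun q => by
        rw [abs_mul]
        gcongr
        exact abs_softField_le ε i a q)
      (fun q => by
        rw [fderiv_const_mul ((contDiff_softField hε.ne' i a (m := 1)).differentiable
          one_ne_zero q), smul_apply, smul_eq_mul, abs_mul]
        gcongr
        exact abs_fderiv_softField_le hε i a q)
  refine le_trans ?_ (Finset.sum_le_sum fun i _ => Finset.sum_le_sum fun a _ => (key i a).2)
  simp_rw [← integral_finsetSum _ fun a _ => (key _ a).1]
  rw [← integral_finsetSum _ fun i _ => integrable_finsetSum _ fun a _ => (key i a).1]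
  refine integral_mono_ae ((H.integrable_potential_add_const_mul _).mono'
    ((continuous_fieldBound μ hε.ne').aestronglyMeasurable.mul H.memLp.norm.integrable_sq.1)
    (ae_norm_fieldBound_mul_le (by omega) μ ε ψ)) (integrable_finsetSum _ fun i _ =>
      integrable_finsetSum _ fun a _ => (key i a).1) (.of_forall fun q => ?_)
  simp only [← Finset.sum_mul]
  gcongr
  exact fieldBound_le hd hε.ne' q

/-- The limit `ε → 0` of `InFormDomain.integral_fieldBound_le`. -/
theorem InFormDomain.integral_fieldBound_zero_le (hd : 2 ≤ d) (H : InFormDomain ψ G) :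
    Integrable (fun q => fieldBound ((d : ℝ) - 1)⁻¹ 0 q * ‖ψ q‖ ^ 2) ∧
      ∫ q, fieldBound ((d : ℝ) - 1)⁻¹ 0 q * ‖ψ q‖ ^ 2 ≤ kineticIntegral G := by
  set μ : ℝ := ((d : ℝ) - 1)⁻¹ with hμ
  have hε : ∀ m : ℕ, (0 : ℝ) < 1 / ((m : ℝ) + 1) := fun m => by positivity
  have hmeas : ∀ m : ℕ, AEStronglyMeasurable
      (fun q : RelConfig d n => fieldBound μ (1 / ((m : ℝ) + 1)) q * ‖ψ q‖ ^ 2) := fun m =>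
    (continuous_fieldBound μ (hε m).ne').aestronglyMeasurable.mul H.memLp.norm.integrable_sq.1
  have hae := ae_injective_positions (n := n) (d := d) (by omega)
  have hbound := fun ε : ℝ => ae_norm_fieldBound_mul_le (n := n) (by omega : 0 < d) μ ε ψ
  have hlim : ∀ᵐ q : RelConfig d n, Tendsto (fun m : ℕ =>
      fieldBound μ (1 / ((m : ℝ) + 1)) q * ‖ψ q‖ ^ 2) atTop
      (𝓝 (fieldBound μ 0 q * ‖ψ q‖ ^ 2)) := by
    filter_upwards [hae] with q hq
    exact ((continuousAt_fieldBound μ hq).tendsto.comp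
      tendsto_one_div_add_atTop_nhds_zero_nat).mul_const _
  have hint := H.integrable_potential_add_const_mul
    (μ ^ 2 * (((n : ℝ) + 1) * (d * ((n : ℝ) + 1) ^ 2)))
  refine ⟨hint.mono' (aestronglyMeasurable_of_tendsto_ae atTop hmeas hlim) (hbound 0), ?_⟩
  exact le_of_tendsto (tendsto_integral_of_dominated_convergence _ hmeas hint
    (fun m => hbound _) hlim) (.of_forall fun m => H.integral_fieldBound_le hd (hε m))

/-- The energy of a state is bounded below in terms of any bound `B` on the angular function, as
`∑_i |G_i|² = N (N - 1) + 2 F_N` almost everywhere. -/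
theorem InFormDomain.le_energy (hd : 2 ≤ d) (H : InFormDomain ψ G) {B : ℝ}
    (hB : ∀ x : Fin (n + 1) → EuclideanSpace ℝ (Fin d), Function.Injective x →
      angularSum x ≤ B) :
    -((((n + 1 : ℕ) : ℝ) * (((n + 1 : ℕ) : ℝ) - 1) / 2 + B) / ((d : ℝ) - 1) ^ 2) *
      ∫ q, ‖ψ q‖ ^ 2 ≤
      1 / 2 * kineticIntegral G + ∫ q, coulombPotential q * ‖ψ q‖ ^ 2 := by
  obtain ⟨hint, hle⟩ := H.integral_fieldBound_zero_le hd
  set μ : ℝ := ((d : ℝ) - 1)⁻¹ with hμ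
  set A : ℝ := ((n + 1 : ℕ) : ℝ) * (((n + 1 : ℕ) : ℝ) - 1) + 2 * B with hA
  have h1 : ∫ q, (-(2 * coulombPotential q) + -(μ ^ 2 * A)) * ‖ψ q‖ ^ 2 ≤
      ∫ q, fieldBound μ 0 q * ‖ψ q‖ ^ 2 := by
    refine integral_mono_ae (H.integrable_potential_add_const_mul _) hint ?_
    filter_upwards [ae_injective_positions (n := n) (d := d) (by omega)] with q hq
    rw [fieldBound_zero μ hq, sub_eq_add_neg]
    gcongr
    rw [hA]
    linarith [hB _ hq]
  have h2 : ∫ q, (-(2 * coulombPotential q) + -(μ ^ 2 * A)) * ‖ψ q‖ ^ 2 =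
      -2 * (∫ q, coulombPotential q * ‖ψ q‖ ^ 2) + -(μ ^ 2 * A) * ∫ q, ‖ψ q‖ ^ 2 := by
    rw [← integral_const_mul, ← integral_const_mul, ← integral_add
      (H.integrable_potential.const_mul _) (H.memLp.norm.integrable_sq.const_mul _)]
    refine integral_congr_ae (.of_forall fun q => ?_)
    simp only
    ring
  have h3 : -((((n + 1 : ℕ) : ℝ) * (((n + 1 : ℕ) : ℝ) - 1) / 2 + B) / ((d : ℝ) - 1) ^ 2) =
      -(μ ^ 2 * A) / 2 := by
    rw [hμ, hA, inv_pow]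
    ring
  rw [h3]
  linarith

end Energy

theorem IsEnergyLevel.le {d n : ℕ} {e : ℝ} (hd : 2 ≤ d) (he : IsEnergyLevel d (n + 1) e) {B : ℝ}
    (hB : ∀ x : Fin (n + 1) → EuclideanSpace ℝ (Fin d), Function.Injective x →
      angularSum x ≤ B) :
    -((((n + 1 : ℕ) : ℝ) * (((n + 1 : ℕ) : ℝ) - 1) / 2 + B) / ((d : ℝ) - 1) ^ 2) ≤ e := by
  obtain ⟨ψ, hψ, -, G, H, hform⟩ : ∃ ψ : RelConfig d n → ℂ, ¬ (ψ =ᵐ[volume] 0) ∧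
    HamiltonianMapsTo ψ (fun q => (e : ℂ) * ψ q) := he
  have h1 := hform ψ G H
  have h2 : ∫ q, conj (ψ q) * ((e : ℂ) * ψ q) = ((e * ∫ q, ‖ψ q‖ ^ 2 : ℝ) : ℂ) := by
    rw [← integral_const_mul, ← integral_complex_ofReal]
    refine integral_congr_ae (.of_forall fun q => ?_)
    simp only
    rw [mul_left_comm, Complex.conj_mul']
    push_cast
    rfl
  rw [energyForm_self, h2, Complex.ofReal_inj] at h1
  have h3 := H.le_energy hd hB
  rw [h1] at h3
  have hpos : 0 < ∫ q, ‖ψ q‖ ^ 2 := by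
    refine (integral_nonneg fun q => sq_nonneg _).lt_of_ne' fun h0 => hψ ?_
    rw [integral_eq_zero_iff_of_nonneg (fun q => sq_nonneg _) H.memLp.norm.integrable_sq] at h0
    filter_upwards [h0] with q hq
    simpa using hq
  exact le_of_mul_le_mul_right h3 hpos

theorem mainTheorem4 (d N : ℕ) (hd : 2 ≤ d) (hN : 2 ≤ N) :
    (∀ e₀ : ℝ, IsLeast {e : ℝ | IsEnergyLevel d N e} e₀ →
      -((N : ℝ) ^ 2 * ((N : ℝ) - 1) / (4 * ((d : ℝ) - 1) ^ 2)) ≤ e₀ ∧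
      ∀ M : ℕ, 3 ≤ M → M ≤ N →
        -((N : ℝ) * ((N : ℝ) - 1) * (1 / 2 + alphaConst d M * ((N : ℝ) - 2)) /
          ((d : ℝ) - 1) ^ 2) ≤ e₀) ∧
    (∀ M : ℕ, 2 ≤ M → IsLUB (angularValues d M) (angularSup d M) ∧
      angularSup d M ≤ (M : ℝ) * ((M : ℝ) - 1) * ((M : ℝ) - 2) / 4) ∧
    (∀ M : ℕ, 3 ≤ M → alphaConst d M ≤ 1 / 4) ∧
    angularSup d 3 = 3 / 2 := by
  refine ⟨fun e₀ he₀ => ?_, fun M hM => ⟨isLUB_angularSup hd hM, angularSup_le hd hM⟩,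
    fun M hM => alphaConst_le hd hM, angularSup_three hd⟩
  obtain ⟨n, rfl⟩ : ∃ n, N = n + 1 := ⟨N - 1, by omega⟩
  have he := he₀.1
  refine ⟨le_trans (le_of_eq ?_) (he.le hd fun x hx => angularSum_le hN hx), fun M hM hMN =>
    le_trans (le_of_eq ?_) (he.le hd fun x hx => angularSum_le_alphaConst hd hM hMN hx)⟩
  · rw [mul_comm (4 : ℝ), ← div_div, div_right_comm]
    congr 2
    ring
  · congr 2
    ring
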